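/- Let $S$ and $T$ be two countably infinite Boolean inverse $\wedge$-monoids which are $0$-simplifying and fundamental. Then the following are equivalent: (1) $S$ and $T$ are isomorphic (as monoids); (2) the groups of units of $S$ and $T$ are isomorphic. Here all inverse monoids have a zero: an inverse monoid is a monoid in which every $a$ has a unique $a^{-1}$ with $aa^{-1}a=a$ and $a^{-1}aa^{-1}=a^{-1}$, it carries the natural partial order ($a\le b$ iff $a=be$ for some idempotent $e$), and $a,b$ are compatible if $ab^{-1}$ and $a^{-1}b$ are idempotents. A Boolean inverse monoid is an inverse monoid with zero in which every compatible pair of elements has a join, multiplication distributes on both sides over all binary joins that exist, and the idempotents form a Boolean algebra under the natural partial order; it is a Boolean inverse $\wedge$-monoid if in addition every two elements have a meet. A $\vee$-ideal is a nonempty two-sided ideal $I$ with $a\vee b\in I$ for all compatible $a,b\in I$. $S$ is $0$-simplifying if its only $\vee$-ideals are $\{0\}$ and $S$. $S$ is fundamental if every element of $S$ that commutes with all idempotents is an idempotent. -/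

import Mathlib

/-- An inverse monoid with zero: every element `a` has a unique generalized inverse `a⁻¹`,
i.e. `a⁻¹` is the only `b` with `a * b * a = a` and `b * a * b = b`. -/
class InverseMonoidWithZero (S : Type*) extends MonoidWithZero S, Inv S where
  mul_inv_mul_self : ∀ a : S, a * a⁻¹ * a = a
  inv_mul_inv_self : ∀ a : S, a⁻¹ * a * a⁻¹ = a⁻¹
  inv_unique : ∀ a b : S, a * b * a = a → b * a * b = b → b = a⁻¹

namespace InverseMonoidWithZero

/-- The set `E(S)` of idempotents of `S`. -/
def idempotents (S : Type*) [InverseMonoidWithZero S] : Set S :=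
  {e : S | IsIdempotentElem e}

variable {S : Type*} [InverseMonoidWithZero S]

/-- The natural partial order: `a` is a restriction of `b`. -/
def NatLE (a b : S) : Prop := ∃ e : S, IsIdempotentElem e ∧ a = b * e

/-- The compatibility relation `a ∼ b`. -/
def Compatible (a b : S) : Prop :=
  IsIdempotentElem (a * b⁻¹) ∧ IsIdempotentElem (a⁻¹ * b)

/-- `c` is the join `a ∨ b` of `a` and `b` in the natural partial order. -/
def IsJoin (a b c : S) : Prop :=
  NatLE a c ∧ NatLE b c ∧ ∀ d : S, NatLE a d → NatLE b d → NatLE c d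

/-- `c` is the meet `a ∧ b` of `a` and `b` in the natural partial order. -/
def IsMeet (a b c : S) : Prop :=
  NatLE c a ∧ NatLE c b ∧ ∀ d : S, NatLE d a → NatLE d b → NatLE d c

/-- All binary joins of compatible pairs exist, and multiplication distributes (on both sides)
over all binary joins that exist. -/
structure IsDistributive (S : Type*) [InverseMonoidWithZero S] : Prop where
  exists_join : ∀ a b : S, Compatible a b → ∃ c : S, IsJoin a b c
  mul_join : ∀ a b c s : S, IsJoin a b c → IsJoin (s * a) (s * b) (s * c)
  join_mul : ∀ a b c s : S, IsJoin a b c → IsJoin (a * s) (b * s) (c * s)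

/-- A Boolean inverse monoid: a distributive inverse monoid whose idempotents form a
(unital) Boolean algebra under the natural partial order. -/
structure IsBoolean (S : Type*) [InverseMonoidWithZero S] : Prop extends IsDistributive S where
  idempotents_boolean : ∃ B : BooleanAlgebra (idempotents S),
    ∀ e f : idempotents S, B.le e f ↔ NatLE (e : S) (f : S)

/-- A Boolean inverse `∧`-monoid: a Boolean inverse monoid in which any two elements
have a meet. -/
structure IsBooleanMeet (S : Type*) [InverseMonoidWithZero S] : Prop extends IsBoolean S where
  exists_meet : ∀ a b : S, ∃ c : S, IsMeet a b c

/-- A `∨`-ideal: a (nonempty, two-sided) ideal closed under binary joins of compatible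
elements. -/
structure IsJoinIdeal (I : Set S) : Prop where
  nonempty : I.Nonempty
  mul_mem_left : ∀ s a : S, a ∈ I → s * a ∈ I
  mul_mem_right : ∀ s a : S, a ∈ I → a * s ∈ I
  join_mem : ∀ a b c : S, a ∈ I → b ∈ I → Compatible a b → IsJoin a b c → c ∈ I

/-- `S` is `0`-simplifying: its only `∨`-ideals are `{0}` and `S`. -/
def IsZeroSimplifying (S : Type*) [InverseMonoidWithZero S] : Prop :=
  ∀ I : Set S, IsJoinIdeal I → I = {0} ∨ I = Set.univ

/-- `S` is fundamental: the idempotents are their own centralizer in `S`. -/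
def IsFundamental (S : Type*) [InverseMonoidWithZero S] : Prop :=
  idempotents S = Set.centralizer (idempotents S)

end InverseMonoidWithZero

/-! The units act on the Boolean algebra of idempotents by `e ↦ u * e * u⁻¹`, and in a fundamental
monoid every element is determined by its action on idempotents. It therefore suffices to recover
the algebra with its action from the abstract group, and then the monoid from its units.

The first half is a Rubin-type reconstruction. The meet of a unit with `1` gives the unit a support.
Since an infinite fundamental `0`-simplifying monoid has no atomic idempotents, and an element with
disjoint domain and range extends to an involutive unit, the action is locally moving and the
supports generate the algebra (`exists_isLocallyMoving`). For such actions disjoint supports imply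
`AlgDisjoint f g`, which in turn forces `supp f` to be disjoint from `supp (g ^ 12)`. This sandwich
is tight enough to express `supp h ≤ supp f` in the language of groups, so a group isomorphism
induces an equivariant isomorphism of the algebras (`IsLocallyMoving.exists_orderIso`).

For the second half, every element is a finite orthogonal join of restrictions of units
(`PiecewiseUnit.of_infinite`). Equivariance thus spreads from units to the whole monoid: each
element of `S` has exactly one partner in `T` acting in the same way, and this pairing is the
isomorphism. -/

open scoped commutatorElement

/-! ### Locally moving actions and the calculus of supports -/

/-- `supp` assigns to every element of `G` its support in the Boolean algebra `B`, for a faithful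
locally moving action of `G` by order automorphisms of `B`. -/
structure IsLocallyMoving {G B : Type*} [Group G] [BooleanAlgebra B] [MulAction G B]
    (supp : G → B) : Prop where
  smul_le_smul : ∀ (g : G) (x y : B), x ≤ y → g • x ≤ g • y
  disjoint_supp_iff : ∀ (g : G) (e : B), Disjoint e (supp g) ↔ ∀ x ≤ e, g • x = x
  eq_one_of_supp : ∀ g : G, supp g = ⊥ → g = 1
  exists_ne_one : ∀ e : B, e ≠ ⊥ → ∃ g : G, g ≠ 1 ∧ supp g ≤ e

/-- An algebraic counterpart, due to Belk, Elliott and Matucci, of disjointness of supports. -/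
def AlgDisjoint {G : Type*} [Group G] (f g : G) : Prop :=
  ∀ h : G, ⁅f, h⁆ ≠ 1 → ∃ f₁ f₂ : G, Commute f₁ g ∧ Commute f₂ g ∧
    ⁅f₁, ⁅f₂, h⁆⁆ ≠ 1 ∧ Commute ⁅f₁, ⁅f₂, h⁆⁆ g

theorem AlgDisjoint.map {G H : Type*} [Group G] [Group H] (φ : G ≃* H) {f g : G}
    (hfg : AlgDisjoint f g) : AlgDisjoint (φ f) (φ g) := by
  intro h hh
  obtain ⟨h, rfl⟩ := φ.surjective h
  obtain ⟨f₁, f₂, h₁, h₂, h₃, h₄⟩ := hfg h fun hc => hh <| by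
    rw [← map_commutatorElement, hc, map_one]
  refine ⟨φ f₁, φ f₂, h₁.map φ, h₂.map φ, ?_, ?_⟩
  · rwa [← map_commutatorElement, ← map_commutatorElement, Ne, map_eq_one_iff φ φ.injective]
  · rw [← map_commutatorElement, ← map_commutatorElement]
    exact h₄.map φ

theorem algDisjoint_map_iff {G H : Type*} [Group G] [Group H] (φ : G ≃* H) {f g : G} :
    AlgDisjoint (φ f) (φ g) ↔ AlgDisjoint f g :=
  ⟨fun h => by simpa using h.map φ.symm, fun h => h.map φ⟩

namespace IsLocallyMoving

variable {G B : Type*} [Group G] [BooleanAlgebra B] [MulAction G B] {supp : G → B}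

theorem smul_le_smul_iff (hs : IsLocallyMoving supp) (g : G) {x y : B} :
    g • x ≤ g • y ↔ x ≤ y :=
  ⟨fun h => by simpa using hs.smul_le_smul g⁻¹ _ _ h, hs.smul_le_smul g x y⟩

/-- The order automorphism of `B` induced by an element of the group. -/
def smulIso (hs : IsLocallyMoving supp) (g : G) : B ≃o B where
  toEquiv := MulAction.toPerm g
  map_rel_iff' := hs.smul_le_smul_iff g

theorem smul_inf (hs : IsLocallyMoving supp) (g : G) (x y : B) : g • (x ⊓ y) = g • x ⊓ g • y :=
  map_inf (hs.smulIso g) x y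

theorem smul_sup (hs : IsLocallyMoving supp) (g : G) (x y : B) : g • (x ⊔ y) = g • x ⊔ g • y :=
  map_sup (hs.smulIso g) x y

theorem smul_compl (hs : IsLocallyMoving supp) (g : G) (x : B) : g • xᶜ = (g • x)ᶜ :=
  map_compl' (hs.smulIso g) x

theorem smul_eq_bot (hs : IsLocallyMoving supp) (g : G) {x : B} : g • x = ⊥ ↔ x = ⊥ :=
  map_eq_bot_iff (f := hs.smulIso g)

theorem disjoint_smul (hs : IsLocallyMoving supp) (g : G) {x y : B} :
    Disjoint (g • x) (g • y) ↔ Disjoint x y := by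
  rw [disjoint_iff, disjoint_iff, ← hs.smul_inf, hs.smul_eq_bot]

theorem le_supp_iff (hs : IsLocallyMoving supp) (g : G) (e : B) :
    supp g ≤ e ↔ ∀ x, Disjoint x e → g • x = x := by
  have h := hs.disjoint_supp_iff g eᶜ
  rw [disjoint_comm, disjoint_compl_right_iff] at h
  rw [h]
  exact forall_congr' fun x => by rw [le_compl_iff_disjoint_right]

theorem smul_eq_of_disjoint (hs : IsLocallyMoving supp) {g : G} {x : B}
    (h : Disjoint x (supp g)) : g • x = x :=
  (hs.disjoint_supp_iff g x).1 h x le_rfl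

theorem supp_ne_bot (hs : IsLocallyMoving supp) {g : G} (h : g ≠ 1) : supp g ≠ ⊥ :=
  fun h' => h (hs.eq_one_of_supp g h')

theorem supp_one (hs : IsLocallyMoving supp) : supp 1 = ⊥ :=
  le_bot_iff.1 <| (hs.le_supp_iff 1 ⊥).2 fun x _ => one_smul G x

theorem eq_of_forall_smul (hs : IsLocallyMoving supp) {g h : G} (H : ∀ x : B, g • x = h • x) :
    g = h := by
  have : supp (h⁻¹ * g) = ⊥ := le_bot_iff.1 <| (hs.le_supp_iff _ ⊥).2 fun x _ => by
    rw [mul_smul, H, inv_smul_smul]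
  exact (inv_mul_eq_one.1 (hs.eq_one_of_supp _ this)).symm

theorem supp_mul_le (hs : IsLocallyMoving supp) (g h : G) : supp (g * h) ≤ supp g ⊔ supp h := by
  refine (hs.le_supp_iff _ _).2 fun x hx => ?_
  rw [disjoint_sup_right] at hx
  rw [mul_smul, hs.smul_eq_of_disjoint hx.2, hs.smul_eq_of_disjoint hx.1]

theorem supp_inv_le (hs : IsLocallyMoving supp) (g : G) : supp g⁻¹ ≤ supp g := by
  refine (hs.le_supp_iff _ _).2 fun x hx => ?_
  rw [inv_smul_eq_iff, hs.smul_eq_of_disjoint hx]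

theorem supp_inv (hs : IsLocallyMoving supp) (g : G) : supp g⁻¹ = supp g :=
  le_antisymm (hs.supp_inv_le g) (by simpa using hs.supp_inv_le g⁻¹)

theorem supp_conj_le (hs : IsLocallyMoving supp) (g h : G) : supp (g * h * g⁻¹) ≤ g • supp h := by
  refine (hs.le_supp_iff _ _).2 fun x hx => ?_
  rw [← hs.disjoint_smul g⁻¹, inv_smul_smul] at hx
  rw [mul_smul, mul_smul, hs.smul_eq_of_disjoint hx, smul_inv_smul]

theorem supp_conj (hs : IsLocallyMoving supp) (g h : G) : supp (g * h * g⁻¹) = g • supp h := by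
  refine le_antisymm (hs.supp_conj_le g h) ?_
  rw [← hs.smul_le_smul_iff g⁻¹, inv_smul_smul]
  simpa [mul_assoc] using hs.supp_conj_le g⁻¹ (g * h * g⁻¹)

theorem smul_supp_of_commute (hs : IsLocallyMoving supp) {g h : G} (H : Commute g h) :
    g • supp h = supp h := by
  rw [← hs.supp_conj, H.eq, mul_inv_cancel_right]

theorem supp_pow_le (hs : IsLocallyMoving supp) (g : G) (n : ℕ) : supp (g ^ n) ≤ supp g := by
  induction n with
  | zero => simp [hs.supp_one]
  | succ n ih => rw [pow_succ]; exact (hs.supp_mul_le _ _).trans (sup_le ih le_rfl)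

theorem supp_le_of_dvd (hs : IsLocallyMoving supp) (g : G) {m n : ℕ} (h : m ∣ n) :
    supp (g ^ n) ≤ supp (g ^ m) := by
  obtain ⟨k, rfl⟩ := h
  rw [pow_mul]
  exact hs.supp_pow_le _ _

/-! ### Displacement, commutation and algebraic disjointness -/

theorem commute_of_disjoint (hs : IsLocallyMoving supp) {f g : G}
    (h : Disjoint (supp f) (supp g)) : Commute f g := by
  -- Compare `f * g` and `g * f` separately on the parts of `x` inside and outside `supp f`: `g`
  -- fixes everything inside, `f` everything outside, and both parts stay on their side.
  refine hs.eq_of_forall_smul fun x => ?_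
  have hf : f • supp f = supp f := hs.smul_supp_of_commute (Commute.refl f)
  have hg : g • supp f = supp f := hs.smul_eq_of_disjoint h
  have h₁ : (f * g) • (x ⊓ supp f) = (g * f) • (x ⊓ supp f) := by
    have h₂ : Disjoint (f • (x ⊓ supp f)) (supp g) := by
      rw [hs.smul_inf, hf]
      exact h.mono_left inf_le_right
    rw [mul_smul, mul_smul, hs.smul_eq_of_disjoint h₂,
      hs.smul_eq_of_disjoint (h.mono_left (inf_le_right : x ⊓ supp f ≤ _))]
  have h₂ : (f * g) • (x ⊓ (supp f)ᶜ) = (g * f) • (x ⊓ (supp f)ᶜ) := by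
    have h₃ : Disjoint (g • (x ⊓ (supp f)ᶜ)) (supp f) := by
      rw [hs.smul_inf, hs.smul_compl, hg]
      exact disjoint_compl_left.mono_left inf_le_right
    rw [mul_smul, mul_smul, hs.smul_eq_of_disjoint h₃, hs.smul_eq_of_disjoint
      (disjoint_compl_left.mono_left (inf_le_right : x ⊓ (supp f)ᶜ ≤ _))]
  have h₃ : x = (x ⊓ supp f) ⊔ (x ⊓ (supp f)ᶜ) := by rw [← inf_sup_left]; simp
  rw [h₃, hs.smul_sup, hs.smul_sup, h₁, h₂]

theorem exists_disjoint_smul (hs : IsLocallyMoving supp) {g : G} {e : B} (he : e ≠ ⊥)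
    (heg : e ≤ supp g) : ∃ x ≤ e, x ≠ ⊥ ∧ Disjoint (g • x) x := by
  have h : ¬ Disjoint e (supp g) := fun h => he (disjoint_self.1 (h.mono_right heg))
  rw [hs.disjoint_supp_iff] at h
  push Not at h
  obtain ⟨x, hxe, hx⟩ := h
  -- A moved `x` differs from its image, so one of `x \ g • x` and `g • x \ x` is nonzero. The first
  -- is displaced by `g`; the second is pulled back by `g⁻¹` to land below `x`.
  by_cases hle : x ≤ g • x
  · have hgx : ¬ g • x ≤ x := fun h => hx (le_antisymm h hle)
    refine ⟨g⁻¹ • (g • x \ x), ?_, ?_, ?_⟩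
    · refine le_trans ?_ hxe
      rw [← hs.smul_le_smul_iff g, smul_inv_smul]
      exact sdiff_le
    · rwa [Ne, hs.smul_eq_bot, sdiff_eq_bot_iff]
    · rw [smul_inv_smul]
      refine disjoint_sdiff_self_left.mono_right ?_
      rw [← hs.smul_le_smul_iff g, smul_inv_smul]
      exact sdiff_le
  · refine ⟨x \ g • x, sdiff_le.trans hxe, by rwa [Ne, sdiff_eq_bot_iff], ?_⟩
    exact disjoint_sdiff_self_right.mono_left (hs.smul_le_smul g _ _ sdiff_le)

theorem exists_disjoint_smul_of_list (hs : IsLocallyMoving supp) (l : List G) {e : B} (he : e ≠ ⊥)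
    (hl : ∀ g ∈ l, e ≤ supp g) : ∃ x ≤ e, x ≠ ⊥ ∧ ∀ g ∈ l, Disjoint (g • x) x := by
  induction l with
  | nil => exact ⟨e, le_rfl, he, by simp⟩
  | cons g l ih =>
    obtain ⟨x, hxe, hx, hxl⟩ := ih fun a ha => hl a (List.mem_cons_of_mem _ ha)
    obtain ⟨y, hyx, hy, hyg⟩ := hs.exists_disjoint_smul hx (hxe.trans (hl g List.mem_cons_self))
    refine ⟨y, hyx.trans hxe, hy, fun a ha => ?_⟩
    rcases List.mem_cons.1 ha with rfl | ha
    · exact hyg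
    · exact (hxl a ha).mono (hs.smul_le_smul a _ _ hyx) hyx

/-- An element commuting with `g` preserves `supp g`, but `h` moves it off itself. This is the
source of all noncommutation below. -/
theorem not_commute_of_disjoint_smul (hs : IsLocallyMoving supp) {g h : G} {e : B} (hg : g ≠ 1)
    (hge : supp g ≤ e) (he : Disjoint (h • e) e) : ¬ Commute h g := by
  intro hc
  have h₁ := hs.smul_supp_of_commute hc
  have h₂ : Disjoint (supp g) (supp g) :=
    he.mono (h₁ ▸ hs.smul_le_smul h _ _ hge) hge
  exact hs.supp_ne_bot hg (disjoint_self.1 h₂)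

/-- Nest the choices: `e` below `supp f` displaced by `h`, then `f₂` supported in `e`, then `e'`
displaced by `f₂`, then `f₁` supported in `e'`. On `e'` the commutator of `f₂` and `h` acts like
`f₂`, so it does not commute with `f₁`. The double commutator lives on `e'` and its image under
`f₂`, still inside `supp f`, hence commutes with `g`. -/
theorem algDisjoint_of_disjoint (hs : IsLocallyMoving supp) {f g : G}
    (hfg : Disjoint (supp f) (supp g)) : AlgDisjoint f g := by
  intro h hh
  have h₀ : supp f ⊓ supp h ≠ ⊥ := fun h' =>
    hh (commutatorElement_eq_one_iff_commute.2 (hs.commute_of_disjoint (disjoint_iff.2 h')))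
  obtain ⟨e, hef, he, hhe⟩ := hs.exists_disjoint_smul h₀ inf_le_right
  replace hef := hef.trans inf_le_left
  obtain ⟨f₂, hf₂, hf₂e⟩ := hs.exists_ne_one e he
  obtain ⟨e', he'f, he', hfe'⟩ := hs.exists_disjoint_smul (hs.supp_ne_bot hf₂) le_rfl
  obtain ⟨f₁, hf₁, hf₁e⟩ := hs.exists_ne_one e' he'
  have hc : ∀ a : G, supp a ≤ supp f → Commute a g := fun a ha =>
    hs.commute_of_disjoint (hfg.mono_left ha)
  have hk : ⁅f₂, h⁆ • e' = f₂ • e' := by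
    have h₁ : Disjoint e' (supp (h * f₂⁻¹ * h⁻¹)) := by
      rw [hs.supp_conj, hs.supp_inv, disjoint_comm]
      exact hhe.mono (hs.smul_le_smul h _ _ hf₂e) (he'f.trans hf₂e)
    rw [commutatorElement_def, mul_assoc, mul_assoc, mul_smul, ← mul_assoc,
      hs.smul_eq_of_disjoint h₁]
  have hk' : f₂ • e' ≤ supp f := by
    have h₁ := hs.smul_le_smul f₂ _ _ he'f
    rw [hs.smul_supp_of_commute (Commute.refl f₂)] at h₁
    exact h₁.trans (hf₂e.trans hef)
  refine ⟨f₁, f₂, hc _ (hf₁e.trans (he'f.trans (hf₂e.trans hef))), hc _ (hf₂e.trans hef), ?_,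
    hc _ ?_⟩
  · rw [Ne, commutatorElement_eq_one_iff_commute]
    exact fun h' => hs.not_commute_of_disjoint_smul hf₁ hf₁e (hk ▸ hfe') h'.symm
  · have h₁ : ⁅f₁, ⁅f₂, h⁆⁆ = f₁ * (⁅f₂, h⁆ * f₁⁻¹ * ⁅f₂, h⁆⁻¹) := by
      rw [commutatorElement_def f₁]; group
    rw [h₁]
    refine (hs.supp_mul_le _ _).trans (sup_le (hf₁e.trans (he'f.trans (hf₂e.trans hef))) ?_)
    rw [hs.supp_conj, hs.supp_inv]
    exact (hs.smul_le_smul _ _ _ hf₁e).trans (hk ▸ hk')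

/-- Pigeonhole. The `n` pieces `V i` cover the invariant `s`, so do their translates by each power
of `g`. A nonzero `s` thus contains a nonzero `x` lying in some `g ^ j • V i` for each of the `n +
1` values `j ≤ n`; two of these use the same piece, which a power of `g` with exponent at most `n`
was assumed to displace. -/
theorem eq_bot_of_disjoint_pow_smul (hs : IsLocallyMoving supp) {g : G} {s : B} {n : ℕ}
    (V : Fin n → B) (hgs : g • s = s) (hsV : ∀ x ≤ s, (∀ i, Disjoint x (V i)) → x = ⊥)
    (hV : ∀ i, ∀ m ≤ n, m ≠ 0 → Disjoint (g ^ m • V i) (V i)) : s = ⊥ := by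
  by_contra hne
  have hpow : ∀ j : ℕ, g ^ j • s = s := fun j => by
    induction j with
    | zero => simp
    | succ j ih => rw [pow_succ, mul_smul, hgs, ih]
  have key : ∀ k : ℕ, ∃ x ≤ s, x ≠ ⊥ ∧ ∀ j < k, ∃ i, x ≤ g ^ j • V i := by
    intro k
    induction k with
    | zero => exact ⟨s, le_rfl, hne, by simp⟩
    | succ k ih =>
      obtain ⟨x, hxs, hx, hxV⟩ := ih
      have h₁ : ∃ i, ¬ Disjoint x (g ^ k • V i) := by
        by_contra! h
        have h₂ : (g ^ k)⁻¹ • x = ⊥ := hsV _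
          (by rw [← hs.smul_le_smul_iff (g ^ k), smul_inv_smul, hpow]; exact hxs)
          fun i => by rw [← hs.disjoint_smul (g ^ k), smul_inv_smul]; exact h i
        exact hx (by rwa [hs.smul_eq_bot] at h₂)
      obtain ⟨i, hi⟩ := h₁
      refine ⟨x ⊓ g ^ k • V i, inf_le_left.trans hxs, fun h => hi (disjoint_iff.2 h), ?_⟩
      intro j hj
      rcases Nat.lt_succ_iff_lt_or_eq.1 hj with hj | rfl
      · obtain ⟨i', hi'⟩ := hxV j hj
        exact ⟨i', inf_le_left.trans hi'⟩
      · exact ⟨i, inf_le_right⟩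
  obtain ⟨x, -, hx, hxV⟩ := key (n + 1)
  choose a ha using fun j : Fin (n + 1) => hxV j j.2
  have main : ∀ i j : Fin (n + 1), i < j → a i ≠ a j := by
    intro i j hij h
    have h₁ := hV (a i) (j - i) (by omega) (by have : (i : ℕ) < j := hij; omega)
    rw [← hs.disjoint_smul (g ^ (i : ℕ)), ← mul_smul, ← pow_add,
      Nat.add_sub_cancel' (le_of_lt hij : (i : ℕ) ≤ j)] at h₁
    exact hx (disjoint_self.1 (h₁.mono (h ▸ ha j) (ha i)))
  obtain ⟨i, j, hij, h⟩ := Fintype.exists_ne_map_eq_of_card_lt a (by simp)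
  rcases lt_or_gt_of_ne hij with hlt | hlt
  · exact main i j hlt h
  · exact main j i hlt h.symm

/-- The double commutator is a product of four conjugates of `h` or `h⁻¹`, so four translates of `U`
cover its support, which is `g`-invariant. The pigeonhole argument with four pieces needs `U`
displaced by `g ^ m` for `1 ≤ m ≤ 4`; as `12` is the least common multiple of these exponents, `supp
(g ^ 12)` lies below all four supports. Displacement by `f` makes `f` and `h` noncommuting. -/
theorem disjoint_of_algDisjoint (hs : IsLocallyMoving supp) {f g : G} (hfg : AlgDisjoint f g) :
    Disjoint (supp f) (supp (g ^ 12)) := by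
  by_contra hd
  rw [disjoint_iff] at hd
  obtain ⟨U, -, hU, hUl⟩ := hs.exists_disjoint_smul_of_list [f, g ^ 1, g ^ 2, g ^ 3, g ^ 4] hd (by
    have h : ∀ m, m ∣ 12 → supp f ⊓ supp (g ^ 12) ≤ supp (g ^ m) := fun m hm =>
      inf_le_right.trans (hs.supp_le_of_dvd g hm)
    simp only [List.mem_cons, List.not_mem_nil, or_false]
    rintro a (rfl | rfl | rfl | rfl | rfl)
    · exact inf_le_left
    all_goals exact h _ (by norm_num))
  obtain ⟨h, hh, hhU⟩ := hs.exists_ne_one U hU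
  have hfh : ⁅f, h⁆ ≠ 1 := by
    rw [Ne, commutatorElement_eq_one_iff_commute]
    exact hs.not_commute_of_disjoint_smul hh hhU (hUl f List.mem_cons_self)
  obtain ⟨f₁, f₂, h₁, h₂, hc, hcg⟩ := hfg h hfh
  refine hs.supp_ne_bot hc (hs.eq_bot_of_disjoint_pow_smul (g := g) (n := 4)
    ![U, f₁ • U, f₂ • U, (f₁ * f₂) • U] (hs.smul_supp_of_commute hcg.symm) ?_ ?_)
  · intro x hx hd
    have hle : supp ⁅f₁, ⁅f₂, h⁆⁆ ≤ (f₁ * f₂) • U ⊔ f₁ • U ⊔ U ⊔ f₂ • U := by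
      have h₃ : ⁅f₁, ⁅f₂, h⁆⁆ = ((f₁ * f₂) * h * (f₁ * f₂)⁻¹) * (f₁ * h⁻¹ * f₁⁻¹) * h *
          (f₂ * h⁻¹ * f₂⁻¹) := by
        simp only [commutatorElement_def]; group
      rw [h₃]
      refine (hs.supp_mul_le _ _).trans (sup_le_sup ((hs.supp_mul_le _ _).trans (sup_le_sup
        ((hs.supp_mul_le _ _).trans (sup_le_sup ?_ ?_)) hhU)) ?_)
      all_goals
        rw [hs.supp_conj]
        exact hs.smul_le_smul _ _ _ (by simpa [hs.supp_inv] using hhU)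
    refine disjoint_self.1 (Disjoint.mono_right (hx.trans hle) ?_)
    simp only [disjoint_sup_right]
    exact ⟨⟨⟨hd 3, hd 1⟩, hd 0⟩, hd 2⟩
  · have hm : ∀ a : G, Commute a g → ∀ m ≤ 4, m ≠ 0 → Disjoint (g ^ m • a • U) (a • U) := by
      -- Since `a` commutes with `g`, displacement of `U` by `g ^ m` carries over to `a • U`.
      intro a ha m hm hm0
      rw [← mul_smul, ← (ha.pow_right m).eq, mul_smul, hs.disjoint_smul]
      refine hUl _ ?_
      interval_cases m <;> simp at hm0 ⊢
    intro i
    fin_cases i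
    · simpa using hm 1 (Commute.one_left g)
    · exact hm f₁ h₁
    · exact hm f₂ h₂
    · exact hm _ (h₁.mul_left h₂)

/-- If `g ^ (n + 1)` acts trivially below `w`, replace `g` by `g * h` with `h` supported in `w` and
displacing some `v`. The intermediate translates avoid `w`, so `h` acts only once, and the power `n
+ 1` sends `v` to `h • v`. Otherwise `g ^ (n + 1)` moves part of `w`, and shrinking `w` is enough.
-/
theorem exists_disjoint_pow_smul (hs : IsLocallyMoving supp) (n : ℕ) {e : B} (he : e ≠ ⊥) :
    ∃ g : G, supp g ≤ e ∧ ∃ w ≤ e, w ≠ ⊥ ∧ ∀ m ≤ n, m ≠ 0 → Disjoint (g ^ m • w) w := by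
  induction n with
  | zero => exact ⟨1, by simp [hs.supp_one], e, le_rfl, he, fun m hm h => absurd (by omega) h⟩
  | succ n ih =>
    obtain ⟨g, hge, w, hwe, hw, hgw⟩ := ih
    by_cases hd : Disjoint w (supp (g ^ (n + 1)))
    · obtain ⟨h, hh, hhw⟩ := hs.exists_ne_one w hw
      obtain ⟨v, hvh, hv, hhv⟩ := hs.exists_disjoint_smul (hs.supp_ne_bot hh) le_rfl
      have hhv' : h • v ≤ w := by
        have := hs.smul_le_smul h _ _ hvh
        rw [hs.smul_supp_of_commute (Commute.refl h)] at this
        exact this.trans hhw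
      have hpow : ∀ m ≤ n, (g * h) ^ (m + 1) • v = g ^ (m + 1) • h • v := by
        intro m
        induction m with
        | zero => simp [mul_smul]
        | succ m ihm =>
          intro hm
          have h₁ : Disjoint (g ^ (m + 1) • h • v) (supp h) :=
            (hgw (m + 1) hm (by omega)).mono (hs.smul_le_smul _ _ _ hhv') hhw
          rw [pow_succ' _ (m + 1), mul_smul, ihm (by omega), mul_smul,
            hs.smul_eq_of_disjoint h₁, ← mul_smul, ← pow_succ']
      refine ⟨g * h, (hs.supp_mul_le _ _).trans (sup_le hge (hhw.trans hwe)), v,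
        hvh.trans (hhw.trans hwe), hv, fun m hm hm0 => ?_⟩
      obtain ⟨m, rfl⟩ := Nat.exists_eq_succ_of_ne_zero hm0
      rw [Nat.succ_eq_add_one, hpow m (by omega)]
      rcases Nat.lt_or_ge m n with hlt | hge
      · exact (hgw (m + 1) hlt hm0).mono (hs.smul_le_smul _ _ _ hhv') (hvh.trans hhw)
      · obtain rfl : m = n := by omega
        rwa [hs.smul_eq_of_disjoint (hd.mono_left hhv')]
    · obtain ⟨v, hvw, hv, hgv⟩ := hs.exists_disjoint_smul (e := w ⊓ supp (g ^ (n + 1)))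
        (fun h => hd (disjoint_iff.2 h)) inf_le_right
      replace hvw := hvw.trans inf_le_left
      refine ⟨g, hge, v, hvw.trans hwe, hv, fun m hm hm0 => ?_⟩
      rcases Nat.lt_or_ge m (n + 1) with hlt | hge
      · exact (hgw m (by omega) hm0).mono (hs.smul_le_smul _ _ _ hvw) hvw
      · obtain rfl : m = n + 1 := by omega
        exact hgv

/-- Algebraic disjointness controls only `g ^ 12`, so test elements with nontrivial twelfth power
are needed below every nonzero `e`. -/
theorem exists_pow_ne_one (hs : IsLocallyMoving supp) (n : ℕ) (hn : n ≠ 0) {e : B} (he : e ≠ ⊥) :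
    ∃ g : G, supp g ≤ e ∧ g ^ n ≠ 1 := by
  obtain ⟨g, hge, w, -, hw, hd⟩ := hs.exists_disjoint_pow_smul n he
  refine ⟨g, hge, fun h => hw ?_⟩
  simpa [h] using hd n le_rfl hn

/-! ### Recovering the Boolean algebra from the group -/

theorem supp_le_supp_iff_forall_commute (hs : IsLocallyMoving supp) (f h : G) :
    supp h ≤ supp f ↔ ∀ g, AlgDisjoint f g → Commute h (g ^ 12) := by
  refine ⟨fun hle g hg => hs.commute_of_disjoint
    ((hs.disjoint_of_algDisjoint hg).mono_left hle), fun H => ?_⟩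
  -- If `h` moves something outside `supp f`, a test element `g` supported there is algebraically
  -- disjoint from `f`, yet `h` does not commute with `g ^ 12`.
  by_contra hle
  obtain ⟨U, hUe, hU, hhU⟩ := hs.exists_disjoint_smul (e := supp h \ supp f)
    (by rwa [Ne, sdiff_eq_bot_iff]) sdiff_le
  obtain ⟨g, hgU, hg⟩ := hs.exists_pow_ne_one 12 (by norm_num) hU
  refine hs.not_commute_of_disjoint_smul hg ((hs.supp_pow_le _ _).trans hgU) hhU (H g ?_)
  exact hs.algDisjoint_of_disjoint (disjoint_sdiff_self_right.mono_right (hgU.trans hUe))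

theorem supp_le_compl_iff_forall_commute (hs : IsLocallyMoving supp) (e : B) (h : G) :
    supp h ≤ eᶜ ↔ ∀ g, supp g ≤ e → Commute h g := by
  refine ⟨fun hle g hg => hs.commute_of_disjoint
    (disjoint_compl_left.mono hle hg), fun H => ?_⟩
  by_contra hle
  obtain ⟨U, hUe, hU, hhU⟩ := hs.exists_disjoint_smul (e := supp h ⊓ e)
    (fun h' => hle (le_compl_iff_disjoint_right.2 (disjoint_iff.2 h'))) inf_le_left
  obtain ⟨g, hg, hgU⟩ := hs.exists_ne_one U hU
  exact hs.not_commute_of_disjoint_smul hg hgU hhU (H g (hgU.trans (hUe.trans inf_le_right)))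

theorem le_iff_forall_supp_le (hs : IsLocallyMoving supp) {e f : B} :
    e ≤ f ↔ ∀ g, supp g ≤ e → supp g ≤ f := by
  refine ⟨fun h g hg => hg.trans h, fun H => ?_⟩
  by_contra hle
  obtain ⟨g, hg, hge⟩ := hs.exists_ne_one (e \ f) (by rwa [Ne, sdiff_eq_bot_iff])
  refine hs.supp_ne_bot hg (disjoint_self.1 ?_)
  exact disjoint_sdiff_self_left.mono hge (H g (hge.trans sdiff_le))

variable {G' B' : Type*} [Group G'] [BooleanAlgebra B'] [MulAction G' B'] {supp' : G' → B'}

/-- The subgroup of elements supported in `e` encodes `e`. For a support it is defined by a purely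
group-theoretic condition, meets become intersections, and complements become centralizers; all
three are preserved by `φ`. -/
theorem exists_forall_supp_le_iff (hs : IsLocallyMoving supp) (hs' : IsLocallyMoving supp')
    (hgen : ∀ p : B → Prop, (∀ g, p (supp g)) → (∀ e f, p e → p f → p (e ⊓ f)) →
      (∀ e, p e → p eᶜ) → ∀ e, p e) (φ : G ≃* G') (e : B) :
    ∃ e' : B', ∀ g, supp' (φ g) ≤ e' ↔ supp g ≤ e := by
  refine hgen (fun e => ∃ e' : B', ∀ g, supp' (φ g) ≤ e' ↔ supp g ≤ e) ?_ ?_ ?_ e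
  · refine fun f => ⟨supp' (φ f), fun g => ?_⟩
    rw [hs.supp_le_supp_iff_forall_commute, hs'.supp_le_supp_iff_forall_commute,
      ← φ.toEquiv.forall_congr_right]
    refine forall_congr' fun k => ?_
    rw [← algDisjoint_map_iff φ]
    refine imp_congr Iff.rfl ?_
    rw [MulEquiv.toEquiv_eq_coe, MulEquiv.coe_toEquiv, ← map_pow]
    exact commute_map_iff (f := φ) φ.injective
  · rintro e f ⟨e', he⟩ ⟨f', hf⟩
    exact ⟨e' ⊓ f', fun g => by rw [le_inf_iff, le_inf_iff, he, hf]⟩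
  · rintro e ⟨e', he⟩
    refine ⟨e'ᶜ, fun g => ?_⟩
    rw [hs.supp_le_compl_iff_forall_commute, hs'.supp_le_compl_iff_forall_commute,
      ← φ.toEquiv.forall_congr_right]
    refine forall_congr' fun k => ?_
    rw [← he]
    exact imp_congr Iff.rfl (commute_map_iff (f := φ) φ.injective)

/-- **Rubin's theorem** for locally moving actions with supports that generate the algebra. -/
theorem exists_orderIso (hs : IsLocallyMoving supp) (hs' : IsLocallyMoving supp')
    (hgen : ∀ p : B → Prop, (∀ g, p (supp g)) → (∀ e f, p e → p f → p (e ⊓ f)) →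
      (∀ e, p e → p eᶜ) → ∀ e, p e)
    (hgen' : ∀ p : B' → Prop, (∀ g, p (supp' g)) → (∀ e f, p e → p f → p (e ⊓ f)) →
      (∀ e, p e → p eᶜ) → ∀ e, p e) (φ : G ≃* G') :
    ∃ θ : B ≃o B', ∀ g e, θ (g • e) = φ g • θ e := by
  choose θ hθ using hs.exists_forall_supp_le_iff hs' hgen φ
  choose η hη using hs'.exists_forall_supp_le_iff hs hgen' φ.symm
  have hθ' : ∀ e e', (∀ g, supp' (φ g) ≤ e' ↔ supp g ≤ e) → θ e = e' := fun e e' h => by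
    refine le_antisymm ?_ ?_
    all_goals
      refine hs'.le_iff_forall_supp_le.2 fun g hg => ?_
      rw [← φ.apply_symm_apply g] at hg ⊢
    · rwa [h, ← hθ]
    · rwa [hθ, ← h]
  have hη' : ∀ e e', (∀ g, supp (φ.symm g) ≤ e ↔ supp' g ≤ e') → η e' = e := fun e e' h => by
    refine le_antisymm ?_ ?_
    all_goals
      refine hs.le_iff_forall_supp_le.2 fun g hg => ?_
      rw [← φ.symm_apply_apply g] at hg ⊢
    · rwa [h, ← hη]
    · rwa [hη, ← h]
  refine ⟨⟨⟨θ, η, fun e => ?_, fun e => ?_⟩, fun {e f} => ?_⟩, fun g e => ?_⟩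
  · exact hη' _ _ fun g => by rw [← hθ, φ.apply_symm_apply]
  · exact hθ' _ _ fun g => by rw [← hη, φ.symm_apply_apply]
  · change θ e ≤ θ f ↔ e ≤ f
    rw [hs.le_iff_forall_supp_le, hs'.le_iff_forall_supp_le, ← φ.toEquiv.forall_congr_right]
    exact forall_congr' fun g => imp_congr (hθ _ _) (hθ _ _)
  · refine hθ' _ _ fun k => ?_
    -- Equivariance: being supported in `g • e` means that the conjugate by `g⁻¹` is supported in
    -- `e`, and `φ` respects conjugation.
    have h₁ := hs.supp_conj g⁻¹ k
    have h₂ := hs'.supp_conj (φ g)⁻¹ (φ k)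
    rw [← hs.smul_le_smul_iff g⁻¹, ← hs'.smul_le_smul_iff (φ g)⁻¹, ← h₁, ← h₂, inv_smul_smul,
      inv_smul_smul, ← map_inv, ← map_inv, ← map_mul, ← map_mul]
    exact hθ _ _

end IsLocallyMoving

/-! ### Algebra of inverse monoids -/

namespace InverseMonoidWithZero

section Basic

variable {S : Type*} [InverseMonoidWithZero S]

theorem mul_inv_mul_self' (a : S) : a * (a⁻¹ * a) = a := by
  rw [← mul_assoc, mul_inv_mul_self]

theorem isIdempotentElem_mul_inv (a : S) : IsIdempotentElem (a * a⁻¹) := by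
  rw [IsIdempotentElem, ← mul_assoc, mul_inv_mul_self]

theorem isIdempotentElem_inv_mul (a : S) : IsIdempotentElem (a⁻¹ * a) := by
  rw [IsIdempotentElem, ← mul_assoc, inv_mul_inv_self]

theorem inv_eq_self {e : S} (he : IsIdempotentElem e) : e⁻¹ = e :=
  (inv_unique e e (by rw [he.eq, he.eq]) (by rw [he.eq, he.eq])).symm

theorem isIdempotentElem_mul {e f : S} (he : IsIdempotentElem e) (hf : IsIdempotentElem f) :
    IsIdempotentElem (e * f) := by
  have h₁ := mul_inv_mul_self (e * f)
  have h₂ := inv_mul_inv_self (e * f)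
  set x := (e * f)⁻¹
  -- Also `f * x * e` is a generalized inverse of `e * f`, so uniqueness applies. This form makes
  -- `x` idempotent, hence its own inverse, and that inverse is `e * f`.
  have hx : f * x * e = x := by
    refine inv_unique _ _ ?_ ?_
    · calc e * f * (f * x * e) * (e * f) = e * (f * f) * x * (e * e) * f := by
            simp only [mul_assoc]
        _ = e * f := by rw [he.eq, hf.eq]; simpa only [mul_assoc] using h₁
    · calc f * x * e * (e * f) * (f * x * e) = f * (x * ((e * e) * (f * f)) * x) * e := by
            simp only [mul_assoc]
        _ = f * x * e := by rw [he.eq, hf.eq, h₂]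
  have hxx : IsIdempotentElem x := by
    rw [IsIdempotentElem]
    nth_rw 1 [← hx]
    nth_rw 2 [← hx]
    calc f * x * e * (f * x * e) = f * (x * (e * f) * x) * e := by simp only [mul_assoc]
      _ = x := by rw [h₂, hx]
  have : e * f = x⁻¹ := inv_unique _ _ h₂ h₁
  rw [this, inv_eq_self hxx]
  exact hxx

theorem idempotent_mul_comm {e f : S} (he : IsIdempotentElem e) (hf : IsIdempotentElem f) :
    e * f = f * e := by
  have h₁ := isIdempotentElem_mul he hf
  have h₂ := isIdempotentElem_mul hf he
  have h : f * e = (e * f)⁻¹ := by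
    refine inv_unique _ _ ?_ ?_
    · calc e * f * (f * e) * (e * f) = e * (f * f) * (e * e) * f := by simp only [mul_assoc]
        _ = e * f := by rw [he.eq, hf.eq, mul_assoc, h₁.eq]
    · calc f * e * (e * f) * (f * e) = f * (e * e) * (f * f) * e := by simp only [mul_assoc]
        _ = f * e := by rw [he.eq, hf.eq, mul_assoc, h₂.eq]
  rw [h, inv_eq_self h₁]

instance : DivisionMonoid S where
  inv_inv a := (inv_unique _ _ (inv_mul_inv_self a) (mul_inv_mul_self a)).symm
  mul_inv_rev a b := by
    have h := idempotent_mul_comm (isIdempotentElem_mul_inv b) (isIdempotentElem_inv_mul a)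
    refine (inv_unique _ _ ?_ ?_).symm
    · calc a * b * (b⁻¹ * a⁻¹) * (a * b) = a * ((b * b⁻¹) * (a⁻¹ * a)) * b := by
            simp only [mul_assoc]
        _ = (a * a⁻¹ * a) * (b * b⁻¹ * b) := by rw [h]; simp only [mul_assoc]
        _ = a * b := by rw [mul_inv_mul_self, mul_inv_mul_self]
    · calc b⁻¹ * a⁻¹ * (a * b) * (b⁻¹ * a⁻¹) = b⁻¹ * ((a⁻¹ * a) * (b * b⁻¹)) * a⁻¹ := by
            simp only [mul_assoc]
        _ = (b⁻¹ * b * b⁻¹) * (a⁻¹ * a * a⁻¹) := by rw [← h]; simp only [mul_assoc]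
        _ = b⁻¹ * a⁻¹ := by rw [inv_mul_inv_self, inv_mul_inv_self]
  inv_eq_of_mul a b h := (inv_unique a b (by rw [h, one_mul]) (by rw [mul_assoc, h, mul_one])).symm

theorem inv_zero' : (0 : S)⁻¹ = 0 := inv_eq_self (by simp [IsIdempotentElem])

theorem isIdempotentElem_conj (s : S) {e : S} (he : IsIdempotentElem e) :
    IsIdempotentElem (s * e * s⁻¹) := by
  have h := idempotent_mul_comm he (isIdempotentElem_inv_mul s)
  calc s * e * s⁻¹ * (s * e * s⁻¹) = s * (e * (s⁻¹ * s)) * (e * s⁻¹) := by simp only [mul_assoc]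
    _ = (s * s⁻¹ * s) * (e * e) * s⁻¹ := by rw [h]; simp only [mul_assoc]
    _ = s * e * s⁻¹ := by rw [mul_inv_mul_self, he.eq]

theorem conj_mul_self (s : S) {e : S} (he : IsIdempotentElem e) : s * e * s⁻¹ * s = s * e := by
  have h := idempotent_mul_comm he (isIdempotentElem_inv_mul s)
  calc s * e * s⁻¹ * s = s * (e * (s⁻¹ * s)) := by simp only [mul_assoc]
    _ = s * e := by rw [h, ← mul_assoc, ← mul_assoc, mul_inv_mul_self]

theorem eq_mul_of_natLE {a b : S} (h : NatLE a b) : a = b * (a⁻¹ * a) := by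
  obtain ⟨e, he, rfl⟩ := h
  have h := idempotent_mul_comm he (isIdempotentElem_inv_mul b)
  rw [mul_inv_rev, inv_eq_self he]
  calc b * e = (b * b⁻¹ * b) * (e * e) := by rw [mul_inv_mul_self, he.eq]
    _ = b * ((b⁻¹ * b) * e) * e := by simp only [mul_assoc]
    _ = b * (e * b⁻¹ * (b * e)) := by rw [← h]; simp only [mul_assoc]

theorem eq_mul_of_natLE' {a b : S} (h : NatLE a b) : a = a * a⁻¹ * b := by
  obtain ⟨e, he, rfl⟩ := h
  rw [mul_inv_rev, inv_eq_self he, ← mul_assoc, mul_assoc b, he.eq, conj_mul_self b he]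

theorem NatLE.antisymm {a b : S} (h : NatLE a b) (h' : NatLE b a) : a = b := by
  have h₁ := idempotent_mul_comm (isIdempotentElem_inv_mul a) (isIdempotentElem_inv_mul b)
  calc a = b * (a⁻¹ * a) := eq_mul_of_natLE h
    _ = a * (b⁻¹ * b) * (a⁻¹ * a) := by rw [← eq_mul_of_natLE h']
    _ = a * (a⁻¹ * a) * (b⁻¹ * b) := by rw [mul_assoc, ← h₁, ← mul_assoc]
    _ = b := by rw [mul_inv_mul_self', ← eq_mul_of_natLE h']

theorem NatLE.refl (a : S) : NatLE a a := ⟨1, IsIdempotentElem.one, (mul_one a).symm⟩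

theorem IsJoin.unique {a b c d : S} (hc : IsJoin a b c) (hd : IsJoin a b d) : c = d :=
  (hc.2.2 d hd.1 hd.2.1).antisymm (hd.2.2 c hc.1 hc.2.1)

theorem isJoin_zero_left (a : S) : IsJoin 0 a a :=
  ⟨⟨0, IsIdempotentElem.zero, (mul_zero a).symm⟩, NatLE.refl a, fun _ _ h => h⟩

theorem isJoin_zero_right (a : S) : IsJoin a 0 a :=
  ⟨NatLE.refl a, ⟨0, IsIdempotentElem.zero, (mul_zero a).symm⟩, fun _ h _ => h⟩

/-- An inverse monoid acts on its idempotents by `s • e = s * e * s⁻¹`. -/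
instance : MulAction S (idempotents S) where
  smul s e := ⟨s * e * s⁻¹, isIdempotentElem_conj s e.2⟩
  one_smul e := Subtype.ext (by change (1 : S) * e * 1⁻¹ = e; simp)
  mul_smul s t e := Subtype.ext (by
    change s * t * e * (s * t)⁻¹ = s * (t * e * t⁻¹) * s⁻¹; simp [mul_assoc])

theorem coe_smul (s : S) (e : idempotents S) : ((s • e : idempotents S) : S) = s * e * s⁻¹ := rfl

/-- The range idempotent `s * s⁻¹`. -/
def ran (s : S) : idempotents S := ⟨s * s⁻¹, isIdempotentElem_mul_inv s⟩

/-- The domain idempotent `s⁻¹ * s`. -/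
def dom (s : S) : idempotents S := ⟨s⁻¹ * s, isIdempotentElem_inv_mul s⟩

theorem coe_ran (s : S) : (ran s : S) = s * s⁻¹ := rfl

theorem coe_dom (s : S) : (dom s : S) = s⁻¹ * s := rfl

theorem ran_inv (s : S) : ran s⁻¹ = dom s := Subtype.ext (by rw [coe_ran, coe_dom, inv_inv])

theorem dom_inv (s : S) : dom s⁻¹ = ran s := Subtype.ext (by rw [coe_ran, coe_dom, inv_inv])

theorem mul_dom (s : S) : s * dom s = s := mul_inv_mul_self' s

theorem ran_mul_self (s : S) : ran s * s = s := mul_inv_mul_self s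

theorem coe_mul_self (e : idempotents S) : (e : S) * e = e := e.2

theorem coe_inv (e : idempotents S) : (e : S)⁻¹ = e := inv_eq_self e.2

theorem coe_mul_comm (e f : idempotents S) : (e : S) * f = f * e := idempotent_mul_comm e.2 f.2

theorem ran_mul (s t : S) : ran (s * t) = s • ran t :=
  Subtype.ext (by simp [coe_ran, coe_smul, mul_assoc])

theorem ran_coe (e : idempotents S) : ran (e : S) = e :=
  Subtype.ext (by rw [coe_ran, coe_inv, coe_mul_self])

theorem dom_coe (e : idempotents S) : dom (e : S) = e := by rw [← ran_inv, coe_inv, ran_coe]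

theorem smul_eq_ran (s : S) (e : idempotents S) : s • e = ran (s * e) := by
  rw [ran_mul, ran_coe]

theorem natLE_one_iff {a : S} : NatLE a 1 ↔ IsIdempotentElem a :=
  ⟨fun ⟨e, he, h⟩ => by rwa [h, one_mul], fun h => ⟨a, h, (one_mul a).symm⟩⟩

theorem smul_eq_self_of_mul_eq {s : S} {e : idempotents S} (h : s * e = e) : s • e = e := by
  rw [smul_eq_ran, h, ran_coe]

end Basic

/-! ### Boolean idempotents, orthogonal joins and fundamentality -/

/-- The data of a Boolean algebra structure on the idempotents of a distributive inverse monoid,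
with the natural partial order as its order. -/
class BooleanIdempotents (S : Type*) [InverseMonoidWithZero S] extends
    BooleanAlgebra (idempotents S) where
  isDistributive : IsDistributive S
  le_iff_natLE : ∀ e f : idempotents S, e ≤ f ↔ NatLE (e : S) (f : S)

section Boolean

variable {S : Type*} [InverseMonoidWithZero S] [BooleanIdempotents S]

open BooleanIdempotents

theorem le_iff_mul_eq {e f : idempotents S} : e ≤ f ↔ (f : S) * e = e := by
  rw [le_iff_natLE]
  refine ⟨fun h => ?_, fun h => ⟨e, e.2, h.symm⟩⟩
  have h₁ := eq_mul_of_natLE h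
  rw [coe_inv, coe_mul_self] at h₁
  exact h₁.symm

theorem coe_inf (e f : idempotents S) : ((e ⊓ f : idempotents S) : S) = e * f := by
  have h : e ⊓ f = ⟨e * f, isIdempotentElem_mul e.2 f.2⟩ := by
    refine le_antisymm ?_ (le_inf ?_ ?_)
    · rw [le_iff_mul_eq]
      change (e : S) * f * _ = _
      rw [mul_assoc, le_iff_mul_eq.1 (inf_le_right : e ⊓ f ≤ f),
        le_iff_mul_eq.1 (inf_le_left : e ⊓ f ≤ e)]
    · rw [le_iff_mul_eq]
      change (e : S) * (e * f) = e * f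
      rw [← mul_assoc, coe_mul_self]
    · rw [le_iff_mul_eq]
      change (f : S) * (e * f) = e * f
      rw [coe_mul_comm e f, ← mul_assoc, coe_mul_self]
  rw [h]

theorem coe_top : ((⊤ : idempotents S) : S) = 1 := by
  have h : (⟨1, IsIdempotentElem.one⟩ : idempotents S) ≤ ⊤ := le_top
  rw [le_iff_mul_eq] at h
  simpa using h

theorem coe_bot : ((⊥ : idempotents S) : S) = 0 := by
  have h : ⊥ ≤ (⟨0, IsIdempotentElem.zero⟩ : idempotents S) := bot_le
  rw [le_iff_mul_eq] at h
  simpa using h.symm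

theorem coe_eq_zero {e : idempotents S} : (e : S) = 0 ↔ e = ⊥ := by
  rw [← coe_bot, Subtype.coe_inj]

theorem disjoint_iff_mul_eq_zero {e f : idempotents S} : Disjoint e f ↔ (e : S) * f = 0 := by
  rw [disjoint_iff, ← coe_inf, coe_eq_zero]

theorem isJoin_coe_sup (e f : idempotents S) :
    IsJoin (e : S) f ((e ⊔ f : idempotents S) : S) := by
  obtain ⟨c, hc⟩ := (isDistributive (S := S)).exists_join e f
    ⟨by rw [coe_inv]; exact isIdempotentElem_mul e.2 f.2,
      by rw [coe_inv]; exact isIdempotentElem_mul e.2 f.2⟩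
  have hci : IsIdempotentElem c :=
    natLE_one_iff.1 (hc.2.2 1 (natLE_one_iff.2 e.2) (natLE_one_iff.2 f.2))
  have h : e ⊔ f = ⟨c, hci⟩ := by
    refine le_antisymm (sup_le ?_ ?_) ?_
    · exact (le_iff_natLE _ _).2 hc.1
    · exact (le_iff_natLE _ _).2 hc.2.1
    · exact (le_iff_natLE _ _).2 <| hc.2.2 _ ((le_iff_natLE _ _).1 le_sup_left)
        ((le_iff_natLE _ _).1 le_sup_right)
  rw [h]
  exact hc

theorem ran_one : ran (1 : S) = ⊤ := by rw [← coe_top, ran_coe]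

theorem smul_top (s : S) : s • (⊤ : idempotents S) = ran s := by
  rw [smul_eq_ran, coe_top, mul_one]

theorem smul_inf (s : S) (e f : idempotents S) : s • (e ⊓ f) = s • e ⊓ s • f :=
  Subtype.ext <| by
    rw [coe_inf, coe_smul, coe_smul, coe_smul, coe_inf]
    rw [← mul_assoc (s * e * s⁻¹), ← mul_assoc (s * e * s⁻¹), conj_mul_self s e.2]
    simp only [mul_assoc]

theorem smul_mono (s : S) {e f : idempotents S} (h : e ≤ f) : s • e ≤ s • f := by
  rw [← inf_eq_left] at h ⊢
  rw [← smul_inf, h]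

theorem smul_sup (s : S) (e f : idempotents S) : s • (e ⊔ f) = s • e ⊔ s • f := by
  have h := (isDistributive (S := S)).join_mul _ _ _ s⁻¹
    ((isDistributive (S := S)).mul_join _ _ _ s (isJoin_coe_sup e f))
  exact Subtype.ext (h.unique (isJoin_coe_sup (s • e) (s • f)))

theorem ran_le_iff {s : S} {e : idempotents S} : ran s ≤ e ↔ e * s = s := by
  rw [le_iff_mul_eq]
  refine ⟨fun h => ?_, fun h => ?_⟩
  · rw [← ran_mul_self s, ← mul_assoc, h]
  · rw [coe_ran, ← mul_assoc, h]

theorem mul_eq_zero_iff {a b : S} : a * b = 0 ↔ Disjoint (dom a) (ran b) := by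
  rw [disjoint_iff_mul_eq_zero]
  refine ⟨fun h => ?_, fun h => ?_⟩
  · rw [coe_dom, coe_ran, mul_assoc, ← mul_assoc a, h, zero_mul, mul_zero]
  · rw [← mul_dom a, ← ran_mul_self b, mul_assoc, ← mul_assoc _ _ b, h, zero_mul, mul_zero]

theorem ran_mul_le (s t : S) : ran (s * t) ≤ ran s := by
  rw [ran_mul, ← smul_top s]
  exact smul_mono s le_top

theorem dom_mul_le (s t : S) : dom (s * t) ≤ dom t := by
  rw [← ran_inv, ← ran_inv, mul_inv_rev]
  exact ran_mul_le _ _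

theorem coe_smul_eq (e f : idempotents S) : (e : S) • f = e ⊓ f :=
  Subtype.ext <| by rw [coe_smul, coe_inf, coe_inv, mul_assoc, coe_mul_comm f, ← mul_assoc,
    coe_mul_self]

theorem ran_coe_mul (e : idempotents S) (s : S) : ran (e * s) = e ⊓ ran s := by
  rw [ran_mul, coe_smul_eq]

theorem dom_mul_coe (s : S) (e : idempotents S) : dom (s * e) = dom s ⊓ e := by
  rw [← ran_inv, mul_inv_rev, coe_inv, ran_coe_mul, ran_inv, inf_comm]

theorem inv_smul_smul_eq (s : S) (e : idempotents S) : s⁻¹ • s • e = dom s ⊓ e := by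
  rw [← mul_smul, ← coe_dom, coe_smul_eq]

theorem smul_eq_bot_iff {s : S} {e : idempotents S} : s • e = ⊥ ↔ Disjoint (dom s) e := by
  nth_rw 2 [← ran_coe e]
  rw [← mul_eq_zero_iff, smul_eq_ran, ← coe_eq_zero, coe_ran]
  refine ⟨fun h => ?_, fun h => by rw [h, zero_mul]⟩
  rw [← mul_inv_mul_self (s * e), h, zero_mul]

theorem smul_le_ran (s : S) (e : idempotents S) : s • e ≤ ran s := by
  rw [← smul_top]
  exact smul_mono s le_top

theorem smul_isJoin {a b c : S} (h : IsJoin a b c) (e : idempotents S) :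
    c • e = a • e ⊔ b • e := by
  -- A fixed right factor `c⁻¹` can stand in for `x⁻¹` when `x` is a restriction of `c`, so `c * e *
  -- c⁻¹` is reached by right multiplications, which distribute over the join.
  have key : ∀ x : S, NatLE x c → x * e * c⁻¹ = x * e * x⁻¹ := by
    intro x hx
    have h₁ := eq_mul_of_natLE hx
    have h₂ := eq_mul_of_natLE' hx
    have h₃ : x * e * dom x = x * e := by rw [mul_assoc, coe_mul_comm, ← mul_assoc, mul_dom]
    calc x * e * c⁻¹ = x * e * (x⁻¹ * x) * c⁻¹ := by rw [← coe_dom, h₃]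
      _ = x * e * (c * (x⁻¹ * x))⁻¹ := by simp [mul_assoc]
      _ = x * e * x⁻¹ := by rw [← h₁]
  have h₁ := (isDistributive (S := S)).join_mul _ _ _ c⁻¹
    ((isDistributive (S := S)).join_mul _ _ _ (e : S) h)
  rw [key a h.1, key b h.2.1] at h₁
  exact Subtype.ext (h₁.unique (isJoin_coe_sup (a • e) (b • e)))

theorem isJoin_mul_sup (s : S) (e f : idempotents S) :
    IsJoin (s * e) (s * f) (s * (e ⊔ f : idempotents S)) :=
  (isDistributive (S := S)).mul_join _ _ _ s (isJoin_coe_sup e f)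

theorem isJoin_sup_mul (s : S) (e f : idempotents S) :
    IsJoin (e * s) (f * s) ((e ⊔ f : idempotents S) * s) :=
  (isDistributive (S := S)).join_mul _ _ _ s (isJoin_coe_sup e f)

/-- Orthogonality: disjoint domains and disjoint ranges. -/
def Orthogonal (a b : S) : Prop := Disjoint (ran a) (ran b) ∧ Disjoint (dom a) (dom b)

theorem Orthogonal.compatible {a b : S} (h : Orthogonal a b) : Compatible a b := by
  have h₁ : a * b⁻¹ = 0 := by rw [mul_eq_zero_iff, ran_inv]; exact h.2
  have h₂ : a⁻¹ * b = 0 := by rw [mul_eq_zero_iff, dom_inv]; exact h.1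
  exact ⟨h₁ ▸ IsIdempotentElem.zero, h₂ ▸ IsIdempotentElem.zero⟩

theorem Orthogonal.exists_isJoin {a b : S} (h : Orthogonal a b) : ∃ c, IsJoin a b c :=
  (isDistributive (S := S)).exists_join a b h.compatible

theorem Orthogonal.mul_left (s : S) {a b : S} (h : Orthogonal a b) :
    Orthogonal (s * a) (s * b) := by
  refine ⟨?_, h.2.mono (dom_mul_le _ _) (dom_mul_le _ _)⟩
  rw [ran_mul, ran_mul, disjoint_iff, ← smul_inf, h.1.eq_bot, smul_eq_bot_iff]
  exact disjoint_bot_right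

theorem Orthogonal.mul_right (s : S) {a b : S} (h : Orthogonal a b) :
    Orthogonal (a * s) (b * s) := by
  refine ⟨h.1.mono (ran_mul_le _ _) (ran_mul_le _ _), ?_⟩
  rw [← ran_inv, ← ran_inv, mul_inv_rev, mul_inv_rev, ran_mul, ran_mul, disjoint_iff, ← smul_inf,
    ran_inv, ran_inv, h.2.eq_bot, smul_eq_bot_iff]
  exact disjoint_bot_right

/-- The involution that exchanges the domain and the range of `a`. -/
theorem exists_unit_of_disjoint {a : S} (h : Disjoint (dom a) (ran a)) :
    ∃ u : Sˣ, (u : S) * dom a = a ∧ (u : S) * ran a = a⁻¹ ∧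
      (u : S) * ((dom a ⊔ ran a)ᶜ : idempotents S) = ((dom a ⊔ ran a)ᶜ : idempotents S) := by
  have hD := isDistributive (S := S)
  have haa : a * a = 0 := mul_eq_zero_iff.2 h
  have haa' : a⁻¹ * a⁻¹ = 0 := by rw [mul_eq_zero_iff, dom_inv, ran_inv]; exact h.symm
  -- The join of `a` and `a⁻¹` squares to the idempotent `dom a ⊔ ran a`; adding the complementary
  -- idempotent `z` turns it into a unit of square `1`.
  obtain ⟨j, hj⟩ := Orthogonal.exists_isJoin (a := a) (b := a⁻¹)
    ⟨by rw [ran_inv]; exact h.symm, by rw [dom_inv]; exact h⟩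
  have hja : j * a = dom a := by
    have h₁ := hD.join_mul _ _ _ a hj
    rw [haa] at h₁
    exact h₁.unique (isJoin_zero_left _)
  have hja' : j * a⁻¹ = ran a := by
    have h₁ := hD.join_mul _ _ _ a⁻¹ hj
    rw [haa'] at h₁
    exact h₁.unique (isJoin_zero_right _)
  have hjj : j * j = (dom a ⊔ ran a : idempotents S) := by
    have h₁ := hD.mul_join _ _ _ j hj
    rw [hja, hja'] at h₁
    exact h₁.unique (isJoin_coe_sup _ _)
  have hjd : j * dom a = a := by
    have h₁ := hD.join_mul _ _ _ (dom a : S) hj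
    rw [mul_dom, coe_dom, ← mul_assoc, haa', zero_mul] at h₁
    exact h₁.unique (isJoin_zero_right _)
  have hjr : j * ran a = a⁻¹ := by
    have h₁ := hD.join_mul _ _ _ (ran a : S) hj
    rw [coe_ran, ← mul_assoc a, haa, zero_mul, ← mul_assoc a⁻¹, inv_mul_inv_self] at h₁
    exact h₁.unique (isJoin_zero_left _)
  set z : idempotents S := (dom a ⊔ ran a)ᶜ with hz
  have hdz : Disjoint (dom a) z := disjoint_compl_right.mono_left le_sup_left
  have hrz : Disjoint (ran a) z := disjoint_compl_right.mono_left le_sup_right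
  have hjz : j * z = 0 := by
    have h₁ := hD.join_mul _ _ _ (z : S) hj
    rw [(mul_eq_zero_iff (a := a)).2 (by rwa [ran_coe]),
      (mul_eq_zero_iff (a := a⁻¹)).2 (by rwa [ran_coe, dom_inv])] at h₁
    exact h₁.unique (isJoin_zero_left _)
  have hzj : z * j = 0 := by
    have h₁ := hD.mul_join _ _ _ (z : S) hj
    rw [(mul_eq_zero_iff (b := a)).2 (by rw [dom_coe]; exact hrz.symm),
      (mul_eq_zero_iff (b := a⁻¹)).2 (by rw [dom_coe, ran_inv]; exact hdz.symm)] at h₁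
    exact h₁.unique (isJoin_zero_left _)
  obtain ⟨u, hu⟩ := Orthogonal.exists_isJoin (a := j) (b := z) (by
    constructor
    · rw [← dom_inv, ← mul_eq_zero_iff, ← inv_inj, mul_inv_rev, inv_inv, coe_inv, hzj, inv_zero']
    · rw [dom_coe, ← ran_coe z, ← mul_eq_zero_iff, hjz])
  have huz : u * z = z := by
    have h₁ := hD.join_mul _ _ _ (z : S) hu
    rw [hjz, coe_mul_self] at h₁
    exact h₁.unique (isJoin_zero_left _)
  have huj : u * j = (dom a ⊔ ran a : idempotents S) := by
    have h₁ := hD.join_mul _ _ _ j hu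
    rw [hzj, hjj] at h₁
    exact h₁.unique (isJoin_zero_right _)
  have huu : u * u = 1 := by
    have h₁ := hD.mul_join _ _ _ u hu
    rw [huj, huz] at h₁
    have h₂ := h₁.unique (isJoin_coe_sup _ _)
    rwa [hz, sup_compl_eq_top, coe_top] at h₂
  refine ⟨⟨u, u, huu, huu⟩, ?_, ?_, huz⟩
  · have h₁ := hD.join_mul _ _ _ (dom a : S) hu
    rw [hjd, disjoint_iff_mul_eq_zero.1 hdz.symm] at h₁
    exact h₁.unique (isJoin_zero_right _)
  · have h₁ := hD.join_mul _ _ _ (ran a : S) hu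
    rw [hjr, disjoint_iff_mul_eq_zero.1 hrz.symm] at h₁
    exact h₁.unique (isJoin_zero_right _)

/-- An element of a fundamental inverse monoid is determined by its action on idempotents. -/
theorem eq_of_forall_smul_eq (hF : IsFundamental S) {s t : S}
    (h : ∀ e : idempotents S, s • e = t • e) : s = t := by
  have hr : ran s = ran t := by rw [← smul_top, h, smul_top]
  have hd : dom s = dom t := by
    refine compl_injective (eq_of_forall_le_iff fun e => ?_)
    rw [le_compl_iff_disjoint_left, le_compl_iff_disjoint_left, ← smul_eq_bot_iff,
      ← smul_eq_bot_iff, h]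
  -- The element `s⁻¹ * t` acts like the idempotent `dom s`, so it commutes with all idempotents;
  -- fundamentality makes it an idempotent, necessarily `dom s`.
  have hi : ∀ e : idempotents S, (s⁻¹ * t) • e = dom s ⊓ e := fun e => by
    rw [mul_smul, ← h, inv_smul_smul_eq]
  have hc : ∀ e : idempotents S, (s⁻¹ * t) * e = e * (s⁻¹ * t) := fun e => by
    have h₁ := conj_mul_self (s⁻¹ * t) e.2
    rw [← coe_smul, hi, coe_inf, coe_mul_comm, mul_assoc] at h₁
    rw [← h₁, coe_dom, ← mul_assoc (s⁻¹ * s), inv_mul_inv_self]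
  have hid : IsIdempotentElem (s⁻¹ * t) := by
    have : s⁻¹ * t ∈ idempotents S := by
      rw [hF]
      exact fun e he => (hc ⟨e, he⟩).symm
    exact this
  have h₁ : s⁻¹ * t = dom s := by
    have h₂ := hi ⊤
    rw [smul_top, inf_top_eq] at h₂
    rw [← h₂]
    exact congrArg Subtype.val (ran_coe ⟨s⁻¹ * t, hid⟩).symm
  calc s = s * dom s := (mul_dom s).symm
    _ = ran s * t := by rw [← h₁, coe_ran, mul_assoc]
    _ = t := by rw [hr, ran_mul_self]

/-! ### Consequences of `0`-simplicity: no atoms, and plenty of units -/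

/-- An induction principle for `0`-simplifying monoids: the top idempotent is a finite join of
domains of elements with range below a given nonzero idempotent. -/
theorem IsZeroSimplifying.induction (hS : IsZeroSimplifying S) {e : idempotents S} (he : e ≠ ⊥)
    {Q : idempotents S → Prop} (mono : ∀ x y, x ≤ y → Q y → Q x)
    (sup : ∀ x y, Q x → Q y → Q (x ⊔ y)) (base : ∀ t, ran t ≤ e → Q (dom t)) : Q ⊤ := by
  have hmem : ∀ a : S, Q (ran (a * e)) := fun a => by
    rw [← dom_inv]
    refine base _ ?_
    rw [ran_inv, dom_mul_coe]
    exact inf_le_right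
  -- Quantifying over all left multiples makes the set a two-sided ideal. It contains `e ≠ 0`, so it
  -- is everything and contains `1`.
  have hI : IsJoinIdeal {s : S | ∀ a, Q (ran (a * s))} :=
    { nonempty := ⟨e, hmem⟩
      mul_mem_left := fun s a ha b => by rw [← mul_assoc]; exact ha _
      mul_mem_right := fun s a ha b => by
        rw [← mul_assoc]
        exact mono _ _ (ran_mul_le _ _) (ha b)
      join_mem := fun a b c ha hb _ hc x => by
        have h := smul_isJoin ((isDistributive (S := S)).mul_join _ _ _ x hc) ⊤
        rw [smul_top, smul_top, smul_top] at h
        rw [h]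
        exact sup _ _ (ha x) (hb x) }
  rcases hS _ hI with h | h
  · have h₁ : (e : S) ∈ {s : S | ∀ a, Q (ran (a * s))} := hmem
    rw [h] at h₁
    exact absurd (coe_eq_zero.1 h₁) he
  · have h₁ : (1 : S) ∈ {s : S | ∀ a, Q (ran (a * s))} := h ▸ Set.mem_univ _
    simpa [ran_one] using h₁ 1

/-- Below an atom there are only two idempotents, hence finitely many below any domain that maps
injectively under it. By `0`-simplicity there would be finitely many idempotents in all, and the
faithful action on them would make `S` finite. -/
theorem exists_le_ne_bot_sdiff_ne_bot [Infinite S] (hS : IsZeroSimplifying S)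
    (hF : IsFundamental S) {e : idempotents S} (he : e ≠ ⊥) : ∃ f ≤ e, f ≠ ⊥ ∧ e \ f ≠ ⊥ := by
  by_contra! hatom
  have hfin : (Set.Iic (⊤ : idempotents S)).Finite := by
    refine hS.induction he (Q := fun x => (Set.Iic x).Finite) ?_ ?_ ?_
    · exact fun x y hxy hy => hy.subset (Set.Iic_subset_Iic.2 hxy)
    · refine fun x y hx hy => (hx.image2 (· ⊔ ·) hy).subset fun z hz => ?_
      exact ⟨z ⊓ x, inf_le_right, z ⊓ y, inf_le_right, by
        change z ⊓ x ⊔ z ⊓ y = z; rw [← inf_sup_left]; exact inf_eq_left.2 hz⟩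
    · intro t ht
      have hfe : (Set.Iic e).Finite := by
        refine (Set.toFinite {⊥, e}).subset fun f hf => ?_
        by_cases h : f = ⊥
        · exact Or.inl h
        · exact Or.inr (le_antisymm hf (sdiff_eq_bot_iff.1 (hatom f hf h)))
      refine Set.Finite.of_injOn (f := fun x => t • x) (fun x _ => (smul_le_ran t x).trans ht)
        (fun x hx y hy hxy => ?_) hfe
      have h₁ : t⁻¹ • t • x = t⁻¹ • t • y := congrArg _ hxy
      rwa [inv_smul_smul_eq, inv_smul_smul_eq, inf_eq_right.2 hx, inf_eq_right.2 hy] at h₁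
  rw [Set.Iic_top, Set.finite_univ_iff] at hfin
  have : Finite S := Finite.of_injective (fun (s : S) (e : idempotents S) => s • e)
    fun s t hst => eq_of_forall_smul_eq hF fun e => congrFun hst e
  exact not_finite S

/-- The meet of `s` with `1` is the largest idempotent on which `s` restricts to the identity; its
complement is the support. -/
theorem exists_forall_disjoint_iff (hM : ∀ a b : S, ∃ c, IsMeet a b c) (hF : IsFundamental S)
    (s : S) : ∃ c : idempotents S, ∀ e, Disjoint e c ↔ ∀ x ≤ e, s • x = x := by
  obtain ⟨m, hms, hm1, hm⟩ := hM s 1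
  lift m to idempotents S using natLE_one_iff.1 hm1
  refine ⟨mᶜ, fun e => ?_⟩
  rw [disjoint_compl_right_iff]
  have hsm : s * m = m := by
    have := eq_mul_of_natLE hms
    rw [coe_inv, coe_mul_self] at this
    exact this.symm
  refine ⟨fun he x hx => smul_eq_self_of_mul_eq ?_, fun h => ?_⟩
  · rw [← le_iff_mul_eq.1 (hx.trans he), ← mul_assoc, hsm]
  · have hse : s * e = e := by
      refine eq_of_forall_smul_eq hF fun x => ?_
      rw [mul_smul, coe_smul_eq, h _ inf_le_left]
    rw [le_iff_natLE]
    exact hm _ ⟨e, e.2, hse.symm⟩ (natLE_one_iff.2 e.2)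

theorem disjoint_dom_sup_ran_iff {a : S} (h : Disjoint (dom a) (ran a)) {u : Sˣ}
    (hd : (u : S) * dom a = a) (hr : (u : S) * ran a = a⁻¹)
    (hz : (u : S) * ((dom a ⊔ ran a)ᶜ : idempotents S) = ((dom a ⊔ ran a)ᶜ : idempotents S))
    (e : idempotents S) : Disjoint e (dom a ⊔ ran a) ↔ ∀ x ≤ e, u • x = x := by
  refine ⟨fun he x hx => smul_eq_self_of_mul_eq (s := (u : S)) ?_, fun H => ?_⟩
  · rw [← le_iff_mul_eq.1 (hx.trans (le_compl_iff_disjoint_right.2 he)), ← mul_assoc, hz]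
  · have hd' : (u : S) • dom a = ran a := by rw [smul_eq_ran, hd]
    have hr' : (u : S) • ran a = dom a := by rw [smul_eq_ran, hr, ran_inv]
    rw [disjoint_sup_right, disjoint_iff, disjoint_iff, ← le_bot_iff, ← le_bot_iff]
    -- A fixed part of `dom a` equals its own image, which lies in `ran a`, so it vanishes;
    -- symmetrically for `ran a`.
    constructor
    · refine h.le_bot.trans' (le_inf inf_le_right ?_)
      rw [← H (e ⊓ dom a) inf_le_left, ← hd']
      exact smul_mono (u : S) inf_le_right
    · refine h.le_bot.trans' (le_inf ?_ inf_le_right)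
      rw [← H (e ⊓ ran a) inf_le_left, ← hr']
      exact smul_mono (u : S) inf_le_right

theorem supp_eq_dom_sup_ran {supp : Sˣ → idempotents S}
    (hsupp : ∀ u e, Disjoint e (supp u) ↔ ∀ x ≤ e, u • x = x) {a : S}
    (h : Disjoint (dom a) (ran a)) : ∃ u, supp u = dom a ⊔ ran a := by
  obtain ⟨u, hd, hr, hz⟩ := exists_unit_of_disjoint h
  refine ⟨u, compl_injective (eq_of_forall_le_iff fun e => ?_)⟩
  rw [le_compl_iff_disjoint_right, le_compl_iff_disjoint_right, hsupp,
    disjoint_dom_sup_ran_iff h hd hr hz]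

/-- A property of idempotents below `e` follows from the case of domains of elements that
move `e \ f` into `f`. -/
theorem IsZeroSimplifying.induction_sdiff (hS : IsZeroSimplifying S) {e f : idempotents S}
    (hf : f ≠ ⊥) (hfe : f ≤ e) {Q : idempotents S → Prop} (mono : ∀ x y, x ≤ y → Q y → Q x)
    (sup : ∀ x y, Q x → Q y → Q (x ⊔ y))
    (base : ∀ a, Disjoint (dom a) (ran a) → dom a ⊔ ran a ≤ e → Q (dom a)) : Q (e \ f) := by
  have h := hS.induction hf (Q := fun x => Q (x ⊓ e \ f)) ?_ ?_ ?_
  · rwa [top_inf_eq] at h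
  · exact fun x y hxy hy => mono _ _ (inf_le_inf_right _ hxy) hy
  · intro x y hx hy
    rw [inf_sup_right]
    exact sup _ _ hx hy
  · intro t ht
    rw [← dom_mul_coe]
    have h₁ : ran (t * (e \ f : idempotents S)) ≤ f := (ran_mul_le _ _).trans ht
    have h₂ : dom (t * (e \ f : idempotents S)) ≤ e \ f := by
      rw [dom_mul_coe]; exact inf_le_right
    exact base _ (disjoint_sdiff_self_left.mono h₂ h₁)
      (sup_le (h₂.trans sdiff_le) (h₁.trans hfe))

theorem exists_isLocallyMoving [Infinite S] (hM : ∀ a b : S, ∃ c, IsMeet a b c)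
    (hS : IsZeroSimplifying S) (hF : IsFundamental S) :
    ∃ supp : Sˣ → idempotents S, IsLocallyMoving supp ∧
      ∀ p : idempotents S → Prop, (∀ g, p (supp g)) → (∀ e f, p e → p f → p (e ⊓ f)) →
        (∀ e, p e → p eᶜ) → ∀ e, p e := by
  choose supp hsupp using fun u : Sˣ => exists_forall_disjoint_iff hM hF (u : S)
  have hbot : ∀ u, supp u = ⊥ → u = 1 := by
    intro u hu
    refine Units.ext (eq_of_forall_smul_eq hF fun e => ?_)
    rw [(hsupp u e).1 (hu ▸ disjoint_bot_right) e le_rfl, Units.val_one, one_smul]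
  have hone : supp 1 = ⊥ := by
    rw [← disjoint_self, hsupp]
    exact fun x _ => one_smul S x
  refine ⟨supp, ⟨fun g x y => smul_mono (g : S), hsupp, hbot, fun e he => ?_⟩, ?_⟩
  · obtain ⟨f, hfe, hf, hef⟩ := exists_le_ne_bot_sdiff_ne_bot hS hF he
    by_contra! H
    -- If no nontrivial unit were supported in `e`, every swap of a piece of `e \ f` into `f` would
    -- be trivial, forcing `e \ f = ⊥`.
    refine hef (hS.induction_sdiff hf hfe (Q := fun x => x = ⊥) ?_ ?_ ?_)
    · exact fun x y hxy hy => le_bot_iff.1 (hy ▸ hxy)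
    · exact fun x y hx hy => by rw [hx, hy, sup_bot_eq]
    · intro a ha hae
      obtain ⟨u, hu⟩ := supp_eq_dom_sup_ran hsupp ha
      by_cases hu1 : u = 1
      · rw [hu1, hone] at hu
        exact (sup_eq_bot_iff.1 hu.symm).1
      · exact absurd (hu ▸ hae) (H u hu1)
  · intro p hp hinf hcompl e
    have hsup : ∀ e f, p e → p f → p (e ⊔ f) := fun e f he hf => by
      have := hcompl _ (hinf _ _ (hcompl _ he) (hcompl _ hf))
      rwa [compl_inf, compl_compl, compl_compl] at this
    have hpb : p ⊥ := hone ▸ hp 1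
    by_cases he : e = ⊥
    · rwa [he]
    obtain ⟨f, hfe, hf, hef⟩ := exists_le_ne_bot_sdiff_ne_bot hS hF he
    -- Finitely many supports of swaps inside `e` cover `e \ f`. Using this for `f` and for `e \ f`
    -- writes `e` itself as a join of supports.
    have key : ∀ f ≤ e, f ≠ ⊥ → ∃ y ≤ e, p y ∧ e \ f ≤ y := by
      intro f hfe hf
      refine hS.induction_sdiff hf hfe (Q := fun x => ∃ y ≤ e, p y ∧ x ≤ y) ?_ ?_ ?_
      · rintro x x' hx ⟨y, hye, hy, hxy⟩
        exact ⟨y, hye, hy, hx.trans hxy⟩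
      · rintro x x' ⟨y, hye, hy, hxy⟩ ⟨y', hye', hy', hxy'⟩
        exact ⟨y ⊔ y', sup_le hye hye', hsup _ _ hy hy', sup_le_sup hxy hxy'⟩
      · intro a ha hae
        obtain ⟨u, hu⟩ := supp_eq_dom_sup_ran hsupp ha
        exact ⟨_, hae, hu ▸ hp u, le_sup_left⟩
    obtain ⟨y, hye, hy, hfy⟩ := key f hfe hf
    obtain ⟨y', hye', hy', hfy'⟩ := key (e \ f) sdiff_le hef
    rw [sdiff_sdiff_eq_self hfe] at hfy'
    have : e = y ⊔ y' := by
      refine le_antisymm ?_ (sup_le hye hye')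
      calc e = e \ f ⊔ f := (sdiff_sup_cancel hfe).symm
        _ ≤ y ⊔ y' := sup_le_sup hfy hfy'
    rw [this]
    exact hsup _ _ hy hy'

/-! ### Every element is piecewise a unit -/

/-- Finite orthogonal joins of restrictions of units. -/
inductive PiecewiseUnit : S → Prop
  | unit_mul (u : Sˣ) (e : idempotents S) : PiecewiseUnit (u * e)
  | join (a b c : S) (h : Orthogonal a b) (hc : IsJoin a b c) :
      PiecewiseUnit a → PiecewiseUnit b → PiecewiseUnit c

namespace PiecewiseUnit

theorem mul {a b : S} (ha : PiecewiseUnit a) (hb : PiecewiseUnit b) : PiecewiseUnit (a * b) := by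
  have hD := isDistributive (S := S)
  induction ha with
  | unit_mul u e =>
    induction hb with
    | unit_mul v f =>
      -- Moving `e` to the right past `v` conjugates it by `v⁻¹`.
      have h : (u : S) * e * (v * f) = (u * v : Sˣ) * ((v⁻¹ : Sˣ) • e ⊓ f : idempotents S) := by
        rw [coe_inf]
        change _ = _ * (((v⁻¹ : Sˣ) : S) * e * ((v⁻¹ : Sˣ) : S)⁻¹ * f)
        simp [mul_assoc]
      rw [h]
      exact unit_mul _ _
    | join a b c h hc _ _ iha ihb =>
      exact join _ _ _ (h.mul_left _) (hD.mul_join _ _ _ _ hc) iha ihb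
  | join a b c h hc _ _ iha ihb =>
    exact join _ _ _ (h.mul_right _) (hD.join_mul _ _ _ _ hc) iha ihb

theorem of_disjoint {s : S} (h : Disjoint (dom s) (ran s)) : PiecewiseUnit s := by
  obtain ⟨u, hu, -⟩ := exists_unit_of_disjoint h
  rw [← hu]
  exact unit_mul u _

theorem mul_sup {s : S} {x y : idempotents S} (hxy : Disjoint x y) (hx : PiecewiseUnit (s * x))
    (hy : PiecewiseUnit (s * y)) : PiecewiseUnit (s * (x ⊔ y : idempotents S)) :=
  join _ _ _ (Orthogonal.mul_left s ⟨by rwa [ran_coe, ran_coe], by rwa [dom_coe, dom_coe]⟩)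
    (isJoin_mul_sup s x y) hx hy

theorem sup_mul {s : S} {x y : idempotents S} (hxy : Disjoint x y) (hx : PiecewiseUnit (x * s))
    (hy : PiecewiseUnit (y * s)) : PiecewiseUnit ((x ⊔ y : idempotents S) * s) :=
  join _ _ _ (Orthogonal.mul_right s ⟨by rwa [ran_coe, ran_coe], by rwa [dom_coe, dom_coe]⟩)
    (isJoin_sup_mul s x y) hx hy

/-- There is room in `eᶜ` to detour. By `0`-simplicity, `⊤` is covered by idempotents that some `t`
carries into `eᶜ`, and on such a piece `s` factors through `eᶜ` as two elements with disjoint domain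
and range. -/
theorem of_dom_le_of_ran_le (hS : IsZeroSimplifying S) {e : idempotents S} (he : eᶜ ≠ ⊥) {s : S}
    (hd : dom s ≤ e) (hr : ran s ≤ e) : PiecewiseUnit s := by
  have h := hS.induction he (Q := fun x => ∀ z ≤ x, PiecewiseUnit (z * s)) ?_ ?_ ?_
  · simpa [coe_top] using h ⊤ le_rfl
  · exact fun x y hxy hy z hz => hy z (hz.trans hxy)
  · intro x y hx hy z hz
    have h₁ : z = (z ⊓ x) ⊔ (z \ x) := (sup_inf_sdiff z x).symm
    rw [h₁]
    refine sup_mul disjoint_inf_sdiff (hx _ inf_le_right) (hy _ ?_)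
    rwa [sdiff_le_iff]
  · intro t ht z hz
    -- As `z ≤ dom t`, the inserted `t⁻¹ * t` is absorbed by `z`; inserting `e` is harmless because
    -- `ran s ≤ e`.
    have h₁ : (z : S) * s = (t * z * e)⁻¹ * (t * z * s) := by
      calc (z : S) * s = (e * z) * ((z : S) * s) := by
            rw [coe_mul_comm, mul_assoc, ← mul_assoc (e : S), coe_mul_comm e z, mul_assoc,
              ran_le_iff.1 hr, ← mul_assoc, coe_mul_self]
        _ = e * z * (t⁻¹ * t * z) * s := by
            rw [← coe_dom, le_iff_mul_eq.1 hz]; simp only [mul_assoc]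
        _ = _ := by simp [coe_inv, mul_assoc]
    have h₂ : ran (t * z * e) ≤ eᶜ := by
      rw [mul_assoc]; exact (ran_mul_le _ _).trans ht
    have h₃ : ran (t * z * s) ≤ eᶜ := by
      rw [mul_assoc]; exact (ran_mul_le _ _).trans ht
    have h₄ : dom (t * z * e) ≤ e := by rw [dom_mul_coe]; exact inf_le_right
    rw [h₁]
    refine mul (of_disjoint ?_) (of_disjoint ?_)
    · rw [dom_inv, ran_inv]
      exact disjoint_compl_left.mono h₂ h₄
    · exact disjoint_compl_right.mono ((dom_mul_le _ _).trans hd) h₃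

/-- Cut `s` into a two-by-two matrix along a nontrivial `e` and `eᶜ`. Off-diagonal blocks have
disjoint domain and range; diagonal blocks leave a nonzero complement for the detour. -/
theorem of_infinite [Infinite S] (hS : IsZeroSimplifying S) (hF : IsFundamental S) (s : S) :
    PiecewiseUnit s := by
  have htop : (⊤ : idempotents S) ≠ ⊥ := by
    intro h
    have h₁ : ∀ a : S, a = 0 := fun a => by
      rw [← mul_one a, ← coe_top, h, coe_bot, mul_zero]
    have : Subsingleton S := ⟨fun a b => (h₁ a).trans (h₁ b).symm⟩
    exact not_finite S
  obtain ⟨e, -, he, he'⟩ := exists_le_ne_bot_sdiff_ne_bot hS hF htop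
  rw [top_sdiff] at he'
  have main : ∀ x y : idempotents S, (x = e ∨ x = eᶜ) → (y = e ∨ y = eᶜ) →
      PiecewiseUnit (x * s * y) := by
    intro x y hx hy
    have hr : ran (x * s * y) ≤ x := by
      rw [mul_assoc, ran_coe_mul]; exact inf_le_left
    have hd : dom (x * s * y) ≤ y := by rw [dom_mul_coe]; exact inf_le_right
    rcases hx with rfl | rfl <;> rcases hy with rfl | rfl
    · exact of_dom_le_of_ran_le hS he' hd hr
    · exact of_disjoint (disjoint_compl_left.mono hd hr)
    · exact of_disjoint (disjoint_compl_right.mono hd hr)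
    · exact of_dom_le_of_ran_le hS (by rwa [compl_compl]) hd hr
  have hx : ∀ x : idempotents S, (x = e ∨ x = eᶜ) → PiecewiseUnit (x * s) := fun x hx => by
    have := mul_sup disjoint_compl_right (main x e hx (Or.inl rfl)) (main x eᶜ hx (Or.inr rfl))
    rwa [sup_compl_eq_top, coe_top, mul_one] at this
  have := sup_mul disjoint_compl_right (hx e (Or.inl rfl)) (hx eᶜ (Or.inr rfl))
  rwa [sup_compl_eq_top, coe_top, one_mul] at this

end PiecewiseUnit

end Boolean

/-! ### Extending the isomorphism from units to the monoid -/

section Extension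

variable {S T : Type*} [InverseMonoidWithZero S] [InverseMonoidWithZero T]
  [BooleanIdempotents S] [BooleanIdempotents T]

theorem orthogonal_of_forall_smul (θ : idempotents S ≃o idempotents T) {a b : S} {a' b' : T}
    (ha : ∀ e, θ (a • e) = a' • θ e) (hb : ∀ e, θ (b • e) = b' • θ e) (h : Orthogonal a b) :
    Orthogonal a' b' := by
  have hran : ∀ {s : S} {t : T}, (∀ e, θ (s • e) = t • θ e) → θ (ran s) = ran t :=
    fun hst => by rw [← smul_top, hst, map_top, smul_top]
  have hdom : ∀ {s : S} {t : T}, (∀ e, θ (s • e) = t • θ e) → dom t ≤ θ (dom s) := by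
    intro s t hst
    rw [← disjoint_compl_right_iff, ← map_compl' θ, ← smul_eq_bot_iff, ← hst,
      smul_eq_bot_iff.2 disjoint_compl_right, map_bot]
  constructor
  · rw [← hran ha, ← hran hb]
    exact h.1.map_orderIso θ
  · exact (h.2.map_orderIso θ).mono (hdom ha) (hdom hb)

/-- A restricted unit is matched through `φ` and `θ`. For a join, the partners of orthogonal
elements are orthogonal, so their join exists in `T` and acts as required. -/
theorem PiecewiseUnit.exists_forall_smul (θ : idempotents S ≃o idempotents T) (φ : Sˣ → Tˣ)
    (hθ : ∀ (g : Sˣ) e, θ (g • e) = φ g • θ e) {s : S} (hs : PiecewiseUnit s) :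
    ∃ t : T, ∀ e, θ (s • e) = t • θ e := by
  induction hs with
  | unit_mul u f =>
    refine ⟨φ u * θ f, fun e => ?_⟩
    rw [mul_smul, mul_smul, coe_smul_eq, coe_smul_eq, ← map_inf]
    exact hθ u _
  | join a b c h hc _ _ iha ihb =>
    obtain ⟨a', ha⟩ := iha
    obtain ⟨b', hb⟩ := ihb
    obtain ⟨c', hc'⟩ := (orthogonal_of_forall_smul θ ha hb h).exists_isJoin
    exact ⟨c', fun e => by rw [smul_isJoin hc, smul_isJoin hc', map_sup, ha, hb]⟩

/-- Since actions determine elements, the partner of `s` is unique, which gives multiplicativity and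
injectivity; surjectivity is the same construction for `θ.symm`. -/
theorem nonempty_mulEquiv_of_orderIso (hS : ∀ s : S, PiecewiseUnit s)
    (hT : ∀ t : T, PiecewiseUnit t) (hFS : IsFundamental S) (hFT : IsFundamental T)
    (θ : idempotents S ≃o idempotents T) (φ : Sˣ ≃* Tˣ)
    (hθ : ∀ (g : Sˣ) e, θ (g • e) = φ g • θ e) : Nonempty (S ≃* T) := by
  choose F hF using fun s : S => (hS s).exists_forall_smul θ φ hθ
  have hinv : ∀ t : T, ∃ s : S, ∀ e, θ.symm (t • e) = s • θ.symm e := fun t =>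
    (hT t).exists_forall_smul θ.symm φ.symm fun g e => by
      rw [OrderIso.symm_apply_eq, hθ, MulEquiv.apply_symm_apply, OrderIso.apply_symm_apply]
  have hmul : ∀ s t, F (s * t) = F s * F t := fun s t =>
    eq_of_forall_smul_eq hFT fun e => by
      rw [← θ.apply_symm_apply e, ← hF, mul_smul, mul_smul, hF, hF]
  refine ⟨MulEquiv.ofBijective (MulHom.mk F hmul) ⟨fun s t hst => ?_, fun t => ?_⟩⟩
  · refine eq_of_forall_smul_eq hFS fun e => θ.injective ?_
    rw [hF, hF]
    exact congrArg (· • θ e) hst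
  · obtain ⟨s, hs⟩ := hinv t
    refine ⟨s, eq_of_forall_smul_eq hFT fun e => ?_⟩
    change F s • e = t • e
    rw [← θ.apply_symm_apply e, ← hF, ← hs, OrderIso.apply_symm_apply, OrderIso.apply_symm_apply]

end Extension

theorem IsBoolean.nonempty_booleanIdempotents {S : Type*} [InverseMonoidWithZero S]
    (hS : IsBoolean S) : Nonempty (BooleanIdempotents S) := by
  obtain ⟨B, hB⟩ := hS.idempotents_boolean
  exact ⟨{ B with isDistributive := hS.toIsDistributive, le_iff_natLE := hB }⟩

end InverseMonoidWithZero

open InverseMonoidWithZero in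
theorem theorem1p1 {S : Type*} {T : Type*}
    [InverseMonoidWithZero S] [InverseMonoidWithZero T]
    [Countable S] [Infinite S] [Countable T] [Infinite T]
    (hS : InverseMonoidWithZero.IsBooleanMeet S) (hT : InverseMonoidWithZero.IsBooleanMeet T)
    (hS_simplifying : InverseMonoidWithZero.IsZeroSimplifying S)
    (hT_simplifying : InverseMonoidWithZero.IsZeroSimplifying T)
    (hS_fundamental : InverseMonoidWithZero.IsFundamental S)
    (hT_fundamental : InverseMonoidWithZero.IsFundamental T) :
    Nonempty (S ≃* T) ↔ Nonempty (Sˣ ≃* Tˣ) := by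
  refine ⟨fun ⟨φ⟩ => ⟨Units.mapEquiv φ⟩, fun ⟨φ⟩ => ?_⟩
  obtain ⟨_⟩ := hS.toIsBoolean.nonempty_booleanIdempotents
  obtain ⟨_⟩ := hT.toIsBoolean.nonempty_booleanIdempotents
  obtain ⟨supp, hs, hgen⟩ :=
    exists_isLocallyMoving hS.exists_meet hS_simplifying hS_fundamental
  obtain ⟨supp', hs', hgen'⟩ :=
    exists_isLocallyMoving hT.exists_meet hT_simplifying hT_fundamental
  obtain ⟨θ, hθ⟩ := hs.exists_orderIso hs' hgen hgen' φ
  exact nonempty_mulEquiv_of_orderIso (PiecewiseUnit.of_infinite hS_simplifying hS_fundamental)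
    (PiecewiseUnit.of_infinite hT_simplifying hT_fundamental) hS_fundamental hT_fundamental θ φ hθ
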